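/- A duoidal category is a category $\mathcal M$ with two monoidal structures $(\circ, I)$ and $(\bullet, J)$ and with morphisms $\delta : I \to I\bullet I$, $\varpi : J\circ J\to J$, $\tau : I\to J$ and a natural interchange law $\zeta_{A,B,C,D} : (A\bullet B)\circ(C\bullet D)\to (A\circ C)\bullet(B\circ D)$, such that $(J,\varpi,\tau)$ is a monoid in $(\mathcal M,\circ,I)$, $(I,\delta,\tau)$ is a comonoid in $(\mathcal M,\bullet,J)$, and the following hold, where the associativity and unit isomorphisms of $\circ$ and $\bullet$ are suppressed. Associativity: $\zeta_{A\circ C,B\circ D,E,F}\,(\zeta_{A,B,C,D}\circ(E\bullet F))=\zeta_{A,B,C\circ E,D\circ F}\,((A\bullet B)\circ\zeta_{C,D,E,F})$ and $(\zeta_{A,B,D,E}\bullet (C\circ F))\,\zeta_{A\bullet B,C,D\bullet E,F}=((A\circ D)\bullet\zeta_{B,C,E,F})\,\zeta_{A,B\bullet C,D,E\bullet F}$. Unitality: the morphisms $\zeta_{I,I,A,B}(\delta\circ(A\bullet B))$ and $\zeta_{A,B,I,I}((A\bullet B)\circ\delta)$ are the canonical isomorphisms $I\circ(A\bullet B)\cong(I\circ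 A)\bullet(I\circ B)$ and $(A\bullet B)\circ I\cong(A\circ I)\bullet(B\circ I)$, and $(\varpi\bullet(A\circ B))\zeta_{J,A,J,B}$ and $((A\circ B)\bullet\varpi)\zeta_{A,J,B,J}$ are the canonical isomorphisms $(J\bullet A)\circ(J\bullet B)\cong J\bullet(A\circ B)$ and $(A\bullet J)\circ(B\bullet J)\cong(A\circ B)\bullet J$. A bimonoid in $\mathcal M$ is an object $A$ with a monoid structure $(\mu,\eta)$ with respect to $\circ$ and a comonoid structure $(\Delta,\varepsilon)$ with respect to $\bullet$ such that $\Delta\mu = (\mu\bullet\mu)\,\zeta\,(\Delta\circ\Delta)$, $\varepsilon\mu=\varpi(\varepsilon\circ\varepsilon)$, $\Delta\eta=(\eta\bullet\eta)\delta$ and $\varepsilon\eta=\tau$. Write $\mathcal M_J$ for the category of right modules over the monoid $J$ with respect to $\circ$, and $\mathcal M^I$ and $\mathcal M^A$ for the categories of right comodules over the comonoids $I$ and $A$ with respect to $\bullet$. An $A$-Hopf module is an object $X$ with a right $A$-action $\gamma : X\circ A\to X$ and a right $A$-coaction $\rho : X\to X\bullet A$ such that $\rho\gamma=(\gamma\bullet\mu)\,\zeta\,(\rho\circ\Delta)$;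 with the morphisms that preserve both structures these form the category $\mathcal M^A_A$. **Theorem.** Let $\mathcal M$ be a duoidal category in which idempotent morphisms split and such that the functor $$G : \mathcal M_J \xrightarrow{\ U_J\ } \mathcal M \xrightarrow{\ (-)\bullet I\ } \mathcal M^I$$ (forget the $J$-action, then form the $I$-comodule $Q\bullet I$ with the coaction induced by $\delta$) is monadic. Let $A$ be a bimonoid in $\mathcal M$. Suppose that for every right $A$-comodule $(Q,\rho)$ the morphism $$\varsigma_Q : Q\circ A \xrightarrow{\rho\circ A} (Q\bullet A)\circ A \cong (Q\bullet A)\circ(J\bullet A) \xrightarrow{\ \zeta\ } (Q\circ J)\bullet(A\circ A) \xrightarrow{(Q\circ J)\bullet\mu} (Q\circ J)\bullet A$$ is an isomorphism. Then the comparison functor $(-)\bullet A : \mathcal M_J\to\mathcal M^A_A$ is fully faithful. Here, for a $J$-module $(Q,\gamma)$, the coaction on $Q\bullet A$ is $Q\bullet A\xrightarrow{Q\bullet\Delta}Q\bullet(A\bullet A)\cong(Q\bullet A)\bullet A$ and the action is $$(Q\bullet A)\circ A\cong(Q\bullet A)\circ(J\bullet A)\xrightarrow{\ \zeta\ }(Q\circ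 J)\bullet(A\circ A)\xrightarrow{\gamma\bullet\mu}Q\bullet A .$$ -/

import Mathlib

open CategoryTheory

universe v u

/-! ### Right modules and right comodules in a monoidal category -/

section ModulesAndComodules

open MonoidalCategory

/-- A right module `(X, act : X ⊗ R ⟶ X)` over a monoid `R` in a monoidal category. -/
structure RightModule {C : Type u} [Category.{v} C] {_ : MonoidalCategory C} {R : C}
    (mon : MonObj R) where
  X : C
  act : X ⊗ R ⟶ X
  act_one : X ◁ mon.one ≫ act = (ρ_ X).hom
  act_mul : X ◁ mon.mul ≫ act = (α_ X R R).inv ≫ act ▷ R ≫ act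

/-- A right comodule `(X, coact : X ⟶ X ⊗ K)` over a comonoid `K` in a monoidal category. -/
structure RightComodule {C : Type u} [Category.{v} C] {_ : MonoidalCategory C} {K : C}
    (comon : ComonObj K) where
  X : C
  coact : X ⟶ X ⊗ K
  coact_counit : coact ≫ X ◁ comon.counit = (ρ_ X).inv
  coact_comul : coact ≫ X ◁ comon.comul = coact ≫ coact ▷ K ≫ (α_ X K K).hom

variable {C : Type u} [Category.{v} C] {mc : MonoidalCategory C}

namespace RightModule

variable {R : C}

/-- A morphism of right modules. -/
@[ext]
structure Hom {mon : MonObj R} (P Q : RightModule mon) where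
  hom : P.X ⟶ Q.X
  act_hom : P.act ≫ hom = hom ▷ R ≫ Q.act

instance {mon : MonObj R} : Category (RightModule mon) where
  Hom P Q := Hom P Q
  id P := ⟨𝟙 P.X, by simp⟩
  comp f g := ⟨f.hom ≫ g.hom, by
    rw [← Category.assoc, f.act_hom, Category.assoc, g.act_hom, comp_whiskerRight,
      Category.assoc]⟩

/-- The forgetful functor from right modules. -/
def forget (mon : MonObj R) : RightModule mon ⥤ C where
  obj P := P.X
  map f := f.hom

end RightModule

namespace RightComodule

variable {K : C}

/-- A morphism of right comodules. -/
@[ext]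
structure Hom {comon : ComonObj K} (P Q : RightComodule comon) where
  hom : P.X ⟶ Q.X
  hom_coact : hom ≫ Q.coact = P.coact ≫ hom ▷ K

instance {comon : ComonObj K} : Category (RightComodule comon) where
  Hom P Q := Hom P Q
  id P := ⟨𝟙 P.X, by simp⟩
  comp f g := ⟨f.hom ≫ g.hom, by
    rw [Category.assoc, g.hom_coact, ← Category.assoc, f.hom_coact, comp_whiskerRight,
      Category.assoc]⟩

/-- `Y ⊗ K` as a right comodule, through the comultiplication of `K`. -/
def cofreeObj (comon : ComonObj K) (Y : C) : RightComodule comon where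
  X := Y ⊗ K
  coact := Y ◁ comon.comul ≫ (α_ Y K K).inv
  coact_counit := by
    rw [Category.assoc, ← associator_inv_naturality_right, ← whiskerLeft_comp_assoc,
      ComonObj.comul_counit]
    simp
  coact_comul := by
    rw [Category.assoc, ← associator_inv_naturality_right, ← whiskerLeft_comp_assoc,
      ComonObj.comul_assoc]
    simp

/-- The functor `(-) ⊗ K` to right `K`-comodules. -/
def cofree (comon : ComonObj K) : C ⥤ RightComodule comon where
  obj Y := cofreeObj comon Y
  map {Y Z} f :=
    { hom := f ▷ K
      hom_coact := by
        change f ▷ K ≫ Z ◁ comon.comul ≫ (α_ Z K K).inv =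
          (Y ◁ comon.comul ≫ (α_ Y K K).inv) ≫ f ▷ K ▷ K
        simp [← whisker_exchange_assoc] }
  map_id Y := Hom.ext (id_whiskerRight Y K)
  map_comp f g := Hom.ext (comp_whiskerRight f g K)

end RightComodule

end ModulesAndComodules

/-! ### Duoidal categories -/

/-- A category with two monoidal structures: `circ`, with product `∘` and unit `I`, and `bul`,
with product `•` and unit `J`. Their compatibility is the content of `DuoidalCategory`. -/
class TwoMonoidal (M : Type u) [Category.{v} M] where
  circ : MonoidalCategory M
  bul : MonoidalCategory M

/-- The unit of the product `∘`. -/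
notation "𝕀[" M "]" => @MonoidalCategoryStruct.tensorUnit M _
  (@MonoidalCategory.toMonoidalCategoryStruct M _ TwoMonoidal.circ)
/-- The unit of the product `•`. -/
notation "𝕁[" M "]" => @MonoidalCategoryStruct.tensorUnit M _
  (@MonoidalCategory.toMonoidalCategoryStruct M _ TwoMonoidal.bul)
/-- The product `∘` of objects. -/
infixr:70 " ∘ᵈ " => @MonoidalCategoryStruct.tensorObj _ _
  (@MonoidalCategory.toMonoidalCategoryStruct _ _ TwoMonoidal.circ)
/-- The product `•` of objects. -/
infixr:70 " •ᵈ " => @MonoidalCategoryStruct.tensorObj _ _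
  (@MonoidalCategory.toMonoidalCategoryStruct _ _ TwoMonoidal.bul)
/-- The product `∘` of morphisms. -/
infixr:70 " ∘ₘ " => @MonoidalCategoryStruct.tensorHom _ _
  (@MonoidalCategory.toMonoidalCategoryStruct _ _ TwoMonoidal.circ) _ _ _ _
/-- The product `•` of morphisms. -/
infixr:70 " •ₘ " => @MonoidalCategoryStruct.tensorHom _ _
  (@MonoidalCategory.toMonoidalCategoryStruct _ _ TwoMonoidal.bul) _ _ _ _
/-- The morphism `X ∘ f`, for an object `X`. -/
notation:81 X:81 " ◁∘ " f:81 => @MonoidalCategoryStruct.whiskerLeft _ _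
  (@MonoidalCategory.toMonoidalCategoryStruct _ _ TwoMonoidal.circ) X _ _ f
/-- The morphism `X • f`, for an object `X`. -/
notation:81 X:81 " ◁• " f:81 => @MonoidalCategoryStruct.whiskerLeft _ _
  (@MonoidalCategory.toMonoidalCategoryStruct _ _ TwoMonoidal.bul) X _ _ f
/-- The morphism `f ∘ X`, for an object `X`. -/
notation:81 f:81 " ▷∘ " X:81 => @MonoidalCategoryStruct.whiskerRight _ _
  (@MonoidalCategory.toMonoidalCategoryStruct _ _ TwoMonoidal.circ) _ _ f X
/-- The morphism `f • X`, for an object `X`. -/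
notation:81 f:81 " ▷• " X:81 => @MonoidalCategoryStruct.whiskerRight _ _
  (@MonoidalCategory.toMonoidalCategoryStruct _ _ TwoMonoidal.bul) _ _ f X
/-- The associativity and unit constraints of `∘` and `•`. -/
notation "α∘" => @MonoidalCategoryStruct.associator _ _
  (@MonoidalCategory.toMonoidalCategoryStruct _ _ TwoMonoidal.circ)
notation "α•" => @MonoidalCategoryStruct.associator _ _
  (@MonoidalCategory.toMonoidalCategoryStruct _ _ TwoMonoidal.bul)
notation "λ∘" => @MonoidalCategoryStruct.leftUnitor _ _
  (@MonoidalCategory.toMonoidalCategoryStruct _ _ TwoMonoidal.circ)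
notation "λ•" => @MonoidalCategoryStruct.leftUnitor _ _
  (@MonoidalCategory.toMonoidalCategoryStruct _ _ TwoMonoidal.bul)
notation "ρ∘" => @MonoidalCategoryStruct.rightUnitor _ _
  (@MonoidalCategory.toMonoidalCategoryStruct _ _ TwoMonoidal.circ)
notation "ρ•" => @MonoidalCategoryStruct.rightUnitor _ _
  (@MonoidalCategory.toMonoidalCategoryStruct _ _ TwoMonoidal.bul)

/-- A duoidal (or 2-monoidal) category. The field `ζ` is the interchange law. The monoid structure
`(ϖ, τ)` of `J` with respect to `∘` is `monJ`, the comonoid structure `(δ, τ)` of `I` with respect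
to `•` is `comonI`, and `unit_eq_counit` says that they share the morphism `τ : I ⟶ J`. -/
class DuoidalCategory (M : Type u) [Category.{v} M] extends TwoMonoidal M where
  monJ : @MonObj M _ TwoMonoidal.circ 𝕁[M]
  comonI : @ComonObj M _ TwoMonoidal.bul 𝕀[M]
  unit_eq_counit : monJ.one = comonI.counit
  ζ : ∀ A B C D : M, (A •ᵈ B) ∘ᵈ (C •ᵈ D) ⟶ (A ∘ᵈ C) •ᵈ (B ∘ᵈ D)
  ζ_natural : ∀ {A A' B B' C C' D D' : M} (f : A ⟶ A') (g : B ⟶ B') (h : C ⟶ C') (k : D ⟶ D'),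
    ((f •ₘ g) ∘ₘ (h •ₘ k)) ≫ ζ A' B' C' D' = ζ A B C D ≫ ((f ∘ₘ h) •ₘ (g ∘ₘ k))
  circ_associativity : ∀ A B C D E F : M,
    (ζ A B C D ▷∘ (E •ᵈ F)) ≫ ζ (A ∘ᵈ C) (B ∘ᵈ D) E F ≫ ((α∘ A C E).hom •ₘ (α∘ B D F).hom) =
      (α∘ (A •ᵈ B) (C •ᵈ D) (E •ᵈ F)).hom ≫ ((A •ᵈ B) ◁∘ ζ C D E F) ≫
        ζ A B (C ∘ᵈ E) (D ∘ᵈ F)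
  bul_associativity : ∀ A B C D E F : M,
    ζ (A •ᵈ B) C (D •ᵈ E) F ≫ (ζ A B D E ▷• (C ∘ᵈ F)) ≫
        (α• (A ∘ᵈ D) (B ∘ᵈ E) (C ∘ᵈ F)).hom =
      ((α• A B C).hom ∘ₘ (α• D E F).hom) ≫ ζ A (B •ᵈ C) D (E •ᵈ F) ≫
        ((A ∘ᵈ D) ◁• ζ B C E F)
  left_unitality_I : ∀ A B : M,
    (comonI.comul ▷∘ (A •ᵈ B)) ≫ ζ 𝕀[M] 𝕀[M] A B ≫ ((λ∘ A).hom •ₘ (λ∘ B).hom) =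
      (λ∘ (A •ᵈ B)).hom
  right_unitality_I : ∀ A B : M,
    ((A •ᵈ B) ◁∘ comonI.comul) ≫ ζ A B 𝕀[M] 𝕀[M] ≫ ((ρ∘ A).hom •ₘ (ρ∘ B).hom) =
      (ρ∘ (A •ᵈ B)).hom
  left_unitality_J : ∀ A B : M,
    ζ 𝕁[M] A 𝕁[M] B ≫ (monJ.mul ▷• (A ∘ᵈ B)) ≫ (λ• (A ∘ᵈ B)).hom =
      (λ• A).hom ∘ₘ (λ• B).hom
  right_unitality_J : ∀ A B : M,
    ζ A 𝕁[M] B 𝕁[M] ≫ ((A ∘ᵈ B) ◁• monJ.mul) ≫ (ρ• (A ∘ᵈ B)).hom =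
      (ρ• A).hom ∘ₘ (ρ• B).hom

open DuoidalCategory

/-- The functor `G : M_J ⥤ M^I` with underlying functor `(-) • I`: it forgets the action of `J`
and then takes `Q` to the comodule `Q • I`, with coaction induced by `I ⟶ I • I`. -/
def functorG (M : Type u) [Category.{v} M] [DuoidalCategory M] :
    RightModule (monJ (M := M)) ⥤ RightComodule (comonI (M := M)) :=
  RightModule.forget monJ ⋙ RightComodule.cofree comonI

/-! ### Bimonoids and Hopf modules -/

/-- A bimonoid in a duoidal category: an object with a monoid structure with respect to `∘` and
a comonoid structure with respect to `•`, subject to the four compatibility axioms. -/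
structure Bimonoid (M : Type u) [Category.{v} M] [DuoidalCategory M] where
  X : M
  mon : @MonObj M _ TwoMonoidal.circ X
  comon : @ComonObj M _ TwoMonoidal.bul X
  mul_comul : mon.mul ≫ comon.comul =
    (comon.comul ∘ₘ comon.comul) ≫ ζ X X X X ≫ (mon.mul •ₘ mon.mul)
  mul_counit : mon.mul ≫ comon.counit =
    (comon.counit ∘ₘ comon.counit) ≫ (monJ (M := M)).mul
  one_comul : mon.one ≫ comon.comul = (comonI (M := M)).comul ≫ (mon.one •ₘ mon.one)
  one_counit : mon.one ≫ comon.counit = (monJ (M := M)).one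

section HopfModules

variable {M : Type u} [Category.{v} M] [DuoidalCategory M]

/-- A (right-right) Hopf module over a bimonoid `A`: a right `A`-module with respect to `∘` and
a right `A`-comodule with respect to `•`, on the same object `X`, with compatible structures. -/
structure HopfModule (A : Bimonoid M) extends
    toModule : RightModule A.mon,
    toComodule : RightComodule A.comon where
  act_coact : act ≫ coact = (coact ∘ₘ A.comon.comul) ≫ ζ X A.X A.X A.X ≫ (act •ₘ A.mon.mul)

namespace HopfModule

variable {A : Bimonoid M}

/-- A morphism of Hopf modules: a morphism of both modules and comodules. -/
@[ext]
structure Hom (P Q : HopfModule A) where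
  hom : P.X ⟶ Q.X
  act_hom : P.act ≫ hom = (hom ▷∘ A.X) ≫ Q.act
  hom_coact : hom ≫ Q.coact = P.coact ≫ (hom ▷• A.X)

instance : Category (HopfModule A) where
  Hom P Q := Hom P Q
  id P := ⟨𝟙 P.X, by simp, by simp⟩
  comp f g := ⟨f.hom ≫ g.hom, by
    rw [← Category.assoc, f.act_hom, Category.assoc, g.act_hom]; simp, by
    rw [Category.assoc, g.hom_coact, ← Category.assoc, f.hom_coact]; simp⟩

end HopfModule

/-- For an `A`-comodule `(Q, ρ)`, the canonical morphism
`ς_Q : Q ∘ A ⟶ (Q • A) ∘ A ≅ (Q • A) ∘ (J • A) ⟶ (Q ∘ J) • (A ∘ A) ⟶ (Q ∘ J) • A`. -/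
def canonicalMap (A : Bimonoid M) (Q : RightComodule A.comon) :
    Q.X ∘ᵈ A.X ⟶ (Q.X ∘ᵈ 𝕁[M]) •ᵈ A.X :=
  (Q.coact ▷∘ A.X) ≫ ((Q.X •ᵈ A.X) ◁∘ (λ• A.X).inv) ≫ ζ Q.X A.X 𝕁[M] A.X ≫
    ((Q.X ∘ᵈ 𝕁[M]) ◁• A.mon.mul)

/-- For a `J`-module `(Q, γ)`, the action of `A` on `Q • A`:
`(Q • A) ∘ A ≅ (Q • A) ∘ (J • A) ⟶ (Q ∘ J) • (A ∘ A) ⟶ Q • A`,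
where the last two arrows are `ζ` and `γ • μ`. -/
def comparisonAct (A : Bimonoid M) (Q : RightModule (monJ (M := M))) :
    (Q.X •ᵈ A.X) ∘ᵈ A.X ⟶ Q.X •ᵈ A.X :=
  ((Q.X •ᵈ A.X) ◁∘ (λ• A.X).inv) ≫ ζ Q.X A.X 𝕁[M] A.X ≫ (Q.act •ₘ A.mon.mul)

open MonoidalCategory

theorem ζ_whiskerLeft (A B : M) {C C' D D' : M} (h : C ⟶ C') (k : D ⟶ D') :
    ((A •ᵈ B) ◁∘ (h •ₘ k)) ≫ ζ A B C' D' = ζ A B C D ≫ ((A ◁∘ h) •ₘ (B ◁∘ k)) := by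
  simpa using ζ_natural (𝟙 A) (𝟙 B) h k

theorem ζ_whiskerRight {A A' B B' : M} (f : A ⟶ A') (g : B ⟶ B') (C D : M) :
    ((f •ₘ g) ▷∘ (C •ᵈ D)) ≫ ζ A' B' C D = ζ A B C D ≫ ((f ▷∘ C) •ₘ (g ▷∘ D)) := by
  simpa using ζ_natural f g (𝟙 C) (𝟙 D)

theorem one_leftUnitor_inv (A : Bimonoid M) :
    A.mon.one ≫ (λ• A.X).inv =
      (comonI (M := M)).comul ≫ ((monJ (M := M)).one •ₘ A.mon.one) := by
  rw [unit_eq_counit, @MonoidalCategory.tensorHom_def M _ TwoMonoidal.bul, ← Category.assoc,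
    (comonI (M := M)).counit_comul, @leftUnitor_inv_naturality M _ TwoMonoidal.bul]

theorem mul_leftUnitor_inv (A : Bimonoid M) :
    A.mon.mul ≫ (λ• A.X).inv =
      ((λ• A.X).inv ∘ₘ (λ• A.X).inv) ≫ ζ 𝕁[M] A.X 𝕁[M] A.X ≫
        ((monJ (M := M)).mul •ₘ A.mon.mul) := by
  have h' : ζ 𝕁[M] A.X 𝕁[M] A.X ≫ ((monJ (M := M)).mul ▷• (A.X ∘ᵈ A.X)) =
      ((λ• A.X).hom ∘ₘ (λ• A.X).hom) ≫ (λ• (A.X ∘ᵈ A.X)).inv := by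
    rw [← left_unitality_J A.X A.X]; simp
  rw [@MonoidalCategory.tensorHom_def M _ TwoMonoidal.bul, ← Category.assoc (ζ _ _ _ _), h']
  simp

theorem comparisonAct_one (A : Bimonoid M) (Q : RightModule (monJ (M := M))) :
    ((Q.X •ᵈ A.X) ◁∘ A.mon.one) ≫ comparisonAct A Q = (ρ∘ (Q.X •ᵈ A.X)).hom := by
  have h0 : ((Q.X •ᵈ A.X) ◁∘ A.mon.one) ≫ ((Q.X •ᵈ A.X) ◁∘ (λ• A.X).inv) =
      ((Q.X •ᵈ A.X) ◁∘ (comonI (M := M)).comul) ≫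
        ((Q.X •ᵈ A.X) ◁∘ ((monJ (M := M)).one •ₘ A.mon.one)) := by
    simp only [← whiskerLeft_comp, one_leftUnitor_inv]
  unfold comparisonAct
  rw [reassoc_of% h0, reassoc_of% ζ_whiskerLeft]
  simp only [tensorHom_comp_tensorHom]
  rw [Q.act_one, A.mon.mul_one, right_unitality_I]

theorem comparisonAct_mul (A : Bimonoid M) (Q : RightModule (monJ (M := M))) :
    ((Q.X •ᵈ A.X) ◁∘ A.mon.mul) ≫ comparisonAct A Q =
      (α∘ (Q.X •ᵈ A.X) A.X A.X).inv ≫ (comparisonAct A Q ▷∘ A.X) ≫ comparisonAct A Q := by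
  have h0 : ((Q.X •ᵈ A.X) ◁∘ A.mon.mul) ≫ ((Q.X •ᵈ A.X) ◁∘ (λ• A.X).inv) =
      ((Q.X •ᵈ A.X) ◁∘ ((λ• A.X).inv ∘ₘ (λ• A.X).inv)) ≫
        ((Q.X •ᵈ A.X) ◁∘ ζ 𝕁[M] A.X 𝕁[M] A.X) ≫
        ((Q.X •ᵈ A.X) ◁∘ ((monJ (M := M)).mul •ₘ A.mon.mul)) := by
    simp only [← whiskerLeft_comp, mul_leftUnitor_inv]
  have h2 : (A.X ◁∘ A.mon.mul) ≫ A.mon.mul =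
      (α∘ A.X A.X A.X).inv ≫ (A.mon.mul ▷∘ A.X) ≫ A.mon.mul := by
    rw [A.mon.mul_assoc]; simp
  have h3 : ((Q.X •ᵈ A.X) ◁∘ ζ 𝕁[M] A.X 𝕁[M] A.X) ≫
      ζ Q.X A.X (𝕁[M] ∘ᵈ 𝕁[M]) (A.X ∘ᵈ A.X) ≫
        ((α∘ Q.X 𝕁[M] 𝕁[M]).inv •ₘ (α∘ A.X A.X A.X).inv) =
      (α∘ (Q.X •ᵈ A.X) (𝕁[M] •ᵈ A.X) (𝕁[M] •ᵈ A.X)).inv ≫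
        (ζ Q.X A.X 𝕁[M] A.X ▷∘ (𝕁[M] •ᵈ A.X)) ≫ ζ (Q.X ∘ᵈ 𝕁[M]) (A.X ∘ᵈ A.X) 𝕁[M] A.X := by
    have := circ_associativity Q.X A.X 𝕁[M] A.X 𝕁[M] A.X
    rw [Iso.eq_inv_comp, ← reassoc_of% this]
    simp
  have h4 : (Q.X ◁∘ (monJ (M := M)).mul ≫ Q.act) •ₘ (A.X ◁∘ A.mon.mul ≫ A.mon.mul) =
      ((α∘ Q.X 𝕁[M] 𝕁[M]).inv •ₘ (α∘ A.X A.X A.X).inv) ≫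
        ((Q.act ▷∘ 𝕁[M]) •ₘ (A.mon.mul ▷∘ A.X)) ≫ (Q.act •ₘ A.mon.mul) := by
    rw [Q.act_mul, h2]; simp
  unfold comparisonAct
  rw [reassoc_of% h0, reassoc_of% ζ_whiskerLeft]
  simp only [tensorHom_comp_tensorHom]
  rw [h4, reassoc_of% h3, ← reassoc_of% ζ_whiskerRight,
    @MonoidalCategory.tensorHom_def M _ TwoMonoidal.circ _ _ _ _ (λ• A.X).inv (λ• A.X).inv]
  simp [← whisker_exchange_assoc]

theorem comul_leftUnitor_inv (A : Bimonoid M) :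
    A.comon.comul ≫ ((λ• A.X).inv ▷• A.X) =
      (λ• A.X).inv ≫ (𝕁[M] ◁• A.comon.comul) ≫ (α• 𝕁[M] A.X A.X).inv := by
  simp

theorem comparisonAct_coact (A : Bimonoid M) (Q : RightModule (monJ (M := M))) :
    comparisonAct A Q ≫ (Q.X ◁• A.comon.comul) ≫ (α• Q.X A.X A.X).inv =
      (((Q.X ◁• A.comon.comul) ≫ (α• Q.X A.X A.X).inv) ∘ₘ A.comon.comul) ≫
        ζ (Q.X •ᵈ A.X) A.X A.X A.X ≫ (comparisonAct A Q •ₘ A.mon.mul) := by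
  have h1 : ζ Q.X (A.X •ᵈ A.X) 𝕁[M] (A.X •ᵈ A.X) ≫
      ((Q.X ∘ᵈ 𝕁[M]) ◁• ζ A.X A.X A.X A.X) ≫
        (α• (Q.X ∘ᵈ 𝕁[M]) (A.X ∘ᵈ A.X) (A.X ∘ᵈ A.X)).inv =
      ((α• Q.X A.X A.X).inv ∘ₘ (α• 𝕁[M] A.X A.X).inv) ≫
        ζ (Q.X •ᵈ A.X) A.X (𝕁[M] •ᵈ A.X) A.X ≫
          (ζ Q.X A.X 𝕁[M] A.X ▷• (A.X ∘ᵈ A.X)) := by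
    have h := bul_associativity Q.X A.X A.X 𝕁[M] A.X A.X
    have h' := congrArg (fun t => ((α• Q.X A.X A.X).inv ∘ₘ (α• 𝕁[M] A.X A.X).inv) ≫ t ≫
      (α• (Q.X ∘ᵈ 𝕁[M]) (A.X ∘ᵈ A.X) (A.X ∘ᵈ A.X)).inv) h
    simpa using h'.symm
  have h2 : (Q.act •ₘ A.mon.mul) ≫ (Q.X ◁• A.comon.comul) ≫ (α• Q.X A.X A.X).inv =
      ((Q.X ∘ᵈ 𝕁[M]) ◁• (A.comon.comul ∘ₘ A.comon.comul)) ≫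
        ((Q.X ∘ᵈ 𝕁[M]) ◁• ζ A.X A.X A.X A.X) ≫
          (α• (Q.X ∘ᵈ 𝕁[M]) (A.X ∘ᵈ A.X) (A.X ∘ᵈ A.X)).inv ≫
            ((Q.act •ₘ A.mon.mul) •ₘ A.mon.mul) := by
    have h : (Q.act •ₘ A.mon.mul) ≫ (Q.X ◁• A.comon.comul) =
        ((Q.X ∘ᵈ 𝕁[M]) ◁• (A.mon.mul ≫ A.comon.comul)) ≫ (Q.act ▷• (A.X •ᵈ A.X)) := by
      simp [tensorHom_def', ← whisker_exchange]
    rw [reassoc_of% h, A.mul_comul]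
    simp [tensorHom_def']
  have h3 : ζ Q.X A.X 𝕁[M] A.X ≫ ((Q.X ∘ᵈ 𝕁[M]) ◁• (A.comon.comul ∘ₘ A.comon.comul)) =
      ((Q.X ◁• A.comon.comul) ∘ₘ (𝕁[M] ◁• A.comon.comul)) ≫
        ζ Q.X (A.X •ᵈ A.X) 𝕁[M] (A.X •ᵈ A.X) := by
    simpa using (ζ_natural (𝟙 Q.X) A.comon.comul (𝟙 𝕁[M]) A.comon.comul).symm
  have h4 : ζ (Q.X •ᵈ A.X) A.X A.X A.X ≫ (((Q.X •ᵈ A.X) ◁∘ (λ• A.X).inv) ▷• (A.X ∘ᵈ A.X)) =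
      (((Q.X •ᵈ A.X) •ᵈ A.X) ◁∘ ((λ• A.X).inv ▷• A.X)) ≫
        ζ (Q.X •ᵈ A.X) A.X (𝕁[M] •ᵈ A.X) A.X := by
    simpa using (ζ_natural (𝟙 (Q.X •ᵈ A.X)) (𝟙 A.X) (λ• A.X).inv (𝟙 A.X)).symm
  have h5 : comparisonAct A Q •ₘ A.mon.mul =
      (((Q.X •ᵈ A.X) ◁∘ (λ• A.X).inv) ▷• (A.X ∘ᵈ A.X)) ≫
        (ζ Q.X A.X 𝕁[M] A.X ▷• (A.X ∘ᵈ A.X)) ≫ ((Q.act •ₘ A.mon.mul) •ₘ A.mon.mul) := by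
    unfold comparisonAct
    simp [MonoidalCategory.tensorHom_def]
  have h6 : ((Q.X •ᵈ A.X) ◁∘ (λ• A.X).inv) ≫
      ((Q.X ◁• A.comon.comul) ∘ₘ (𝕁[M] ◁• A.comon.comul)) ≫
        ((α• Q.X A.X A.X).inv ∘ₘ (α• 𝕁[M] A.X A.X).inv) =
      (((Q.X ◁• A.comon.comul) ≫ (α• Q.X A.X A.X).inv) ∘ₘ A.comon.comul) ≫
        (((Q.X •ᵈ A.X) •ᵈ A.X) ◁∘ ((λ• A.X).inv ▷• A.X)) := by
    simp only [← @id_tensorHom M _ TwoMonoidal.circ, tensorHom_comp_tensorHom,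
      Category.id_comp, Category.comp_id, comul_leftUnitor_inv]
  rw [h5, reassoc_of% h4, ← reassoc_of% h6, ← reassoc_of% h1, ← reassoc_of% h3, ← h2]
  simp [comparisonAct]

/-- The comparison functor `(-) • A : M_J ⥤ M^A_A`. The coaction on `Q • A` is induced by the
comultiplication of `A`, and the action is `comparisonAct`. -/
def comparisonFunctor (A : Bimonoid M) : RightModule (monJ (M := M)) ⥤ HopfModule A where
  obj Q :=
    { X := Q.X •ᵈ A.X
      act := comparisonAct A Q
      act_one := comparisonAct_one A Q
      act_mul := comparisonAct_mul A Q
      coact := (Q.X ◁• A.comon.comul) ≫ (α• Q.X A.X A.X).inv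
      coact_counit := (RightComodule.cofreeObj A.comon Q.X).coact_counit
      coact_comul := (RightComodule.cofreeObj A.comon Q.X).coact_comul
      act_coact := comparisonAct_coact A Q }
  map {P Q} f :=
    { hom := f.hom ▷• A.X
      act_hom := by
        have h := f.act_hom
        have h2 := ζ_whiskerRight f.hom (𝟙 A.X) 𝕁[M] A.X
        simp only [tensorHom_id, id_whiskerRight] at h2
        change comparisonAct A P ≫ (f.hom ▷• A.X) = ((f.hom ▷• A.X) ▷∘ A.X) ≫ comparisonAct A Q
        unfold comparisonAct
        simp only [← whisker_exchange_assoc, reassoc_of% h2, Category.assoc]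
        have h5 : (P.act •ₘ A.mon.mul) ≫ (f.hom ▷• A.X) =
            ((f.hom ▷∘ 𝕁[M]) ▷• (A.X ∘ᵈ A.X)) ≫ (Q.act •ₘ A.mon.mul) := by
          simp only [tensorHom_def', ← whisker_exchange_assoc, Category.assoc,
            ← comp_whiskerRight, h]
        rw [h5]
      hom_coact := ((RightComodule.cofree A.comon).map f.hom).hom_coact }
  map_id Q := HopfModule.Hom.ext (@id_whiskerRight M _ TwoMonoidal.bul Q.X A.X)
  map_comp f g := HopfModule.Hom.ext (@comp_whiskerRight M _ TwoMonoidal.bul _ _ _ f.hom g.hom A.X)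

end HopfModules

/-! Write `e_Q : Q • A ⟶ Q` for the map induced by the counit of `A`, and `π_Q : (Q • A) ∘ J ⟶ Q`
for its extension to a map of `J`-modules. With `L Q = (Q • A) ∘ J`, the map `π` is a natural
transformation from `L` to the identity of `M_J`. The units of `A` and `J` split `G π` naturally.
Hence the fork formed by `L π_P`, `π_{L P}` and `π_P` is sent by `G` to a split coequalizer, and
monadicity of `G` makes `π_P` a coequalizer in `M_J` (`existsUnique_factor_of_monadic_of_split`).

A Hopf module map `h : P • A ⟶ Q • A` gives `h ≫ e_Q`, which extends to a `J`-module map `L P ⟶ Q`.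
This extension coequalizes the pair: that is an equation between maps out of `((P • A) ∘ J) • A`,
and composing it with the isomorphism `ς` of the cofree comodule `P • A` turns it into a consequence
of the `A`-linearity of `h` (`liftHom_cofreeCounit_comp`). So there is a unique `f : P ⟶ Q` through
which the extension factors. Then `e_P ≫ f = h ≫ e_Q`, and a map of cofree comodules is determined
by its composite with the counit, so `h = f • A`. Uniqueness of the factorization gives
faithfulness. -/

open Limits in
/-- If the components of `G π` are naturally split epimorphisms for a monadic functor `G`, then
each component of `π : L ⟶ 𝟭 C` is the coequalizer of its canonical pair. -/
theorem existsUnique_factor_of_monadic_of_split {C : Type*} {D : Type*} [Category.{v} C]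
    [Category.{v} D] (G : C ⥤ D) [MonadicRightAdjoint G] (L : C ⥤ C) (π : L ⟶ 𝟭 C) (s : G ⟶ L ⋙ G)
    (hs : ∀ X, s.app X ≫ G.map (π.app X) = 𝟙 (G.obj X)) {P Q : C} (k : L.obj P ⟶ Q)
    (hk : L.map (π.app P) ≫ k = π.app (L.obj P) ≫ k) : ∃! f : P ⟶ Q, π.app P ≫ f = k := by
  -- Naturality of `π` at the morphism `π_P` itself.
  have w : L.map (π.app P) ≫ π.app P = π.app (L.obj P) ≫ π.app P := by simp
  -- The two splittings are `s` at `P` and at `L P`; their compatibility is the naturality of `s` at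
  -- `π_P`.
  let q : IsSplitCoequalizer (G.map (L.map (π.app P))) (G.map (π.app (L.obj P)))
      (G.map (π.app P)) :=
    { rightSection := s.app P
      leftSection := s.app (L.obj P)
      condition := by simp only [← G.map_comp, w]
      rightSection_π := hs P
      leftSection_bottom := hs (L.obj P)
      leftSection_top := (s.naturality (π.app P)).symm }
  have : G.IsSplitPair (L.map (π.app P)) (π.app (L.obj P)) := ⟨_, _, ⟨q⟩⟩
  -- A monadic functor creates coequalizers of `G`-split pairs, so the coequalizer in `D` is
  -- reflected back to `C`.
  let := Monad.createsGSplitCoequalizersOfMonadic (G := G) (L.map (π.app P)) (π.app (L.obj P))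
  have hl := isColimitOfIsColimitCoforkMap G w q.isCoequalizer
  exact Cofork.IsColimit.existsUnique hl k hk

/-! ### Free modules and cofree comodules -/

section FreeModules

open MonoidalCategory

variable {C : Type u} [Category.{v} C] {mc : MonoidalCategory C}

namespace RightModule

variable {R : C} (mon : MonObj R)

/-- `Y ⊗ R` as a right module, through the multiplication of `R`. -/
def freeObj (Y : C) : RightModule mon where
  X := Y ⊗ R
  act := (α_ Y R R).hom ≫ Y ◁ mon.mul
  act_one := by
    rw [associator_naturality_right_assoc, ← whiskerLeft_comp, MonObj.mul_one]
    simp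
  act_mul := by
    rw [associator_naturality_right_assoc, ← whiskerLeft_comp, comp_whiskerRight, Category.assoc,
      associator_naturality_middle_assoc, ← whiskerLeft_comp, MonObj.mul_assoc]
    simp

/-- The functor `(-) ⊗ R` to right `R`-modules. -/
def free : C ⥤ RightModule mon where
  obj := freeObj mon
  map {Y Z} f :=
    { hom := f ▷ R
      act_hom := by
        change ((α_ Y R R).hom ≫ Y ◁ mon.mul) ≫ f ▷ R =
          f ▷ R ▷ R ≫ (α_ Z R R).hom ≫ Z ◁ mon.mul
        simp [whisker_exchange] }
  map_id Y := Hom.ext (id_whiskerRight Y R)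
  map_comp f g := Hom.ext (comp_whiskerRight f g R)

/-- The unit of the free module construction. -/
def freeUnit (Y : C) : Y ⟶ Y ⊗ R := (ρ_ Y).inv ≫ Y ◁ mon.one

theorem freeUnit_naturality {Y Z : C} (f : Y ⟶ Z) :
    f ≫ freeUnit mon Z = freeUnit mon Y ≫ f ▷ R := by
  simp [freeUnit, whisker_exchange]

variable {mon}

/-- The morphism underlying `lift`. -/
def liftHom {Y : C} (Q : RightModule mon) (f : Y ⟶ Q.X) : Y ⊗ R ⟶ Q.X := f ▷ R ≫ Q.act

/-- The morphism out of a free module induced by a morphism in the base category. -/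
def lift {Y : C} (Q : RightModule mon) (f : Y ⟶ Q.X) : (free mon).obj Y ⟶ Q where
  hom := liftHom Q f
  act_hom := by
    change ((α_ Y R R).hom ≫ Y ◁ mon.mul) ≫ f ▷ R ≫ Q.act = (f ▷ R ≫ Q.act) ▷ R ≫ Q.act
    rw [Category.assoc, whisker_exchange_assoc, Q.act_mul]
    simp

/-- Recovers `f` from its extension; this is how equations of `J`-module maps out of a free module
return to the base category. -/
theorem freeUnit_liftHom {Y : C} (Q : RightModule mon) (f : Y ⟶ Q.X) :
    freeUnit mon Y ≫ liftHom Q f = f := by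
  rw [liftHom, ← reassoc_of% freeUnit_naturality, freeUnit, Category.assoc, Q.act_one,
    Iso.inv_hom_id, Category.comp_id]

theorem lift_comp {Y : C} {P Q : RightModule mon} (f : Y ⟶ P.X) (φ : P ⟶ Q) :
    lift P f ≫ φ = lift Q (f ≫ φ.hom) := by
  refine Hom.ext ?_
  change (f ▷ R ≫ P.act) ≫ φ.hom = (f ≫ φ.hom) ▷ R ≫ Q.act
  rw [Category.assoc, φ.act_hom, comp_whiskerRight, Category.assoc]

theorem free_map_lift {Y Z : C} {Q : RightModule mon} (f : Y ⟶ Z) (g : Z ⟶ Q.X) :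
    (free mon).map f ≫ lift Q g = lift Q (f ≫ g) := by
  refine Hom.ext ?_
  change f ▷ R ≫ g ▷ R ≫ Q.act = (f ≫ g) ▷ R ≫ Q.act
  rw [comp_whiskerRight, Category.assoc]

end RightModule

namespace RightComodule

variable {K : C} (comon : ComonObj K)

/-- The coaction of the cofree comodule. -/
def cofreeCoact (Y : C) : Y ⊗ K ⟶ (Y ⊗ K) ⊗ K := Y ◁ comon.comul ≫ (α_ Y K K).inv

/-- The counit of the cofree comodule construction. -/
def cofreeCounit (Y : C) : Y ⊗ K ⟶ Y := Y ◁ comon.counit ≫ (ρ_ Y).hom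

theorem cofreeCounit_naturality {Y Z : C} (f : Y ⟶ Z) :
    f ▷ K ≫ cofreeCounit comon Z = cofreeCounit comon Y ≫ f := by
  simp [cofreeCounit, ← whisker_exchange_assoc]

/-- Left counitality of `K`, tensored with `Y`. It is a triangle identity for the cofree comodule
adjunction. -/
theorem cofreeCoact_counit (Y : C) :
    cofreeCoact comon Y ≫ cofreeCounit comon Y ▷ K = 𝟙 (Y ⊗ K) := by
  have h : Y ◁ comon.comul ≫ Y ◁ comon.counit ▷ K = Y ◁ (λ_ K).inv := by
    rw [← whiskerLeft_comp, comon.counit_comul]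
  simp [cofreeCoact, cofreeCounit, reassoc_of% h]

/-- A morphism between cofree comodules is determined by its composite with the counit. -/
theorem eq_cofreeCoact_comp {Y Z : C} (φ : Y ⊗ K ⟶ Z ⊗ K)
    (h : φ ≫ cofreeCoact comon Z = cofreeCoact comon Y ≫ φ ▷ K) :
    φ = cofreeCoact comon Y ≫ (φ ≫ cofreeCounit comon Z) ▷ K := by
  rw [comp_whiskerRight, ← reassoc_of% h, cofreeCoact_counit, Category.comp_id]

theorem coact_cofreeCounit {comon : ComonObj K} (N : RightComodule comon) :
    N.coact ≫ cofreeCounit comon N.X = 𝟙 N.X := by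
  rw [cofreeCounit, reassoc_of% N.coact_counit, Iso.inv_hom_id]

/-- The coaction of a cofree comodule, as a morphism of comodules. -/
def toCofree (Y : C) :
    (cofree comon).obj Y ⟶ (cofree comon).obj (Y ⊗ K) where
  hom := cofreeCoact comon Y
  hom_coact := by
    have h := (cofreeObj comon Y).coact_comul
    change cofreeCoact comon Y ≫ (Y ⊗ K) ◁ comon.comul =
      cofreeCoact comon Y ≫ cofreeCoact comon Y ▷ K ≫ (α_ (Y ⊗ K) K K).hom at h
    change cofreeCoact comon Y ≫ (Y ⊗ K) ◁ comon.comul ≫ (α_ (Y ⊗ K) K K).inv =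
      cofreeCoact comon Y ≫ cofreeCoact comon Y ▷ K
    rw [reassoc_of% h, Iso.hom_inv_id, Category.comp_id]

theorem toCofree_naturality {Y Z : C} (f : Y ⟶ Z) :
    (cofree comon).map f ≫ toCofree comon Z = toCofree comon Y ≫ (cofree comon).map (f ▷ K) :=
  Hom.ext ((cofree comon).map f).hom_coact

theorem toCofree_counit (Y : C) :
    toCofree comon Y ≫ (cofree comon).map (cofreeCounit comon Y) = 𝟙 _ :=
  Hom.ext (cofreeCoact_counit comon Y)

end RightComodule

end FreeModules

/-! ### The split natural transformation `π` -/

section Comparison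

open MonoidalCategory RightModule RightComodule

variable {M : Type u} [Category.{v} M] [DuoidalCategory M] (A : Bimonoid M)

/-- The endofunctor `Q ↦ (Q • A) ∘ J` of right `J`-modules. -/
def freeCofree : RightModule (monJ (M := M)) ⥤ RightModule (monJ (M := M)) :=
  RightModule.forget monJ ⋙ @tensorRight M _ TwoMonoidal.bul A.X ⋙ RightModule.free monJ

/-- The morphism `(Q • A) ∘ J ⟶ Q` of `J`-modules induced by the counit of `A`. -/
def freeCofreeCounit : freeCofree A ⟶ 𝟭 (RightModule (monJ (M := M))) where
  app Q := RightModule.lift Q (cofreeCounit A.comon Q.X)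
  naturality {P Q} f := by
    change (RightModule.free monJ).map (f.hom ▷• A.X) ≫
        RightModule.lift Q (cofreeCounit A.comon Q.X) =
      RightModule.lift P (cofreeCounit A.comon P.X) ≫ f
    rw [free_map_lift, lift_comp, cofreeCounit_naturality]

/-- The bimonoid axiom `εη = τ`: restricting along the unit of `A` replaces the counit of `A` by
that of `I`. -/
theorem one_cofreeCounit (Y : M) :
    (Y ◁• A.mon.one) ≫ cofreeCounit A.comon Y = cofreeCounit (comonI (M := M)) Y := by
  have h : A.mon.one ≫ A.comon.counit = (comonI (M := M)).counit := by
    rw [A.one_counit, unit_eq_counit]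
  have h' : (Y ◁• A.mon.one) ≫ (Y ◁• A.comon.counit) = Y ◁• (comonI (M := M)).counit := by
    rw [← @whiskerLeft_comp M _ TwoMonoidal.bul, h]
  rw [cofreeCounit, cofreeCounit, reassoc_of% h']

/-- The section of `functorG` applied to `freeCofreeCounit` given by the unit of `A`. -/
def freeCofreeSection : functorG M ⟶ freeCofree A ⋙ functorG M where
  app Q := toCofree comonI Q.X ≫ (RightComodule.cofree comonI).map
    ((Q.X ◁• A.mon.one) ≫ freeUnit monJ (Q.X •ᵈ A.X))
  naturality {P Q} f := by
    have h : (f.hom ▷• 𝕀[M]) ≫ (Q.X ◁• A.mon.one) ≫ freeUnit monJ (Q.X •ᵈ A.X) =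
        ((P.X ◁• A.mon.one) ≫ freeUnit monJ (P.X •ᵈ A.X)) ≫ ((f.hom ▷• A.X) ▷∘ 𝕁[M]) := by
      rw [← @whisker_exchange_assoc M _ TwoMonoidal.bul, freeUnit_naturality, Category.assoc]
    change (RightComodule.cofree comonI).map f.hom ≫ toCofree comonI Q.X ≫
        (RightComodule.cofree comonI).map
          ((Q.X ◁• A.mon.one) ≫ freeUnit (monJ (M := M)) (Q.X •ᵈ A.X)) =
      (toCofree comonI P.X ≫ (RightComodule.cofree comonI).map
        ((P.X ◁• A.mon.one) ≫ freeUnit (monJ (M := M)) (P.X •ᵈ A.X))) ≫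
        (RightComodule.cofree comonI).map ((f.hom ▷• A.X) ▷∘ 𝕁[M])
    rw [reassoc_of% toCofree_naturality, ← Functor.map_comp, h, Functor.map_comp, Category.assoc]

/-- The unit of `J` cancels against the extension to the free module, and the unit of `A` turns
`e_Q` into the counit of the cofree `I`-comodule, which the coaction splits. -/
theorem freeCofreeSection_counit (Q : RightModule (monJ (M := M))) :
    (freeCofreeSection A).app Q ≫ (functorG M).map ((freeCofreeCounit A).app Q) =
      𝟙 ((functorG M).obj Q) := by
  have h : ((Q.X ◁• A.mon.one) ≫ freeUnit monJ (Q.X •ᵈ A.X)) ≫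
      liftHom Q (cofreeCounit A.comon Q.X) = cofreeCounit (comonI (M := M)) Q.X := by
    rw [Category.assoc, freeUnit_liftHom, one_cofreeCounit]
  change (toCofree comonI Q.X ≫ (RightComodule.cofree comonI).map
      ((Q.X ◁• A.mon.one) ≫ freeUnit (monJ (M := M)) (Q.X •ᵈ A.X))) ≫
    (RightComodule.cofree comonI).map (liftHom Q (cofreeCounit A.comon Q.X)) =
      𝟙 ((RightComodule.cofree comonI).obj Q.X)
  rw [Category.assoc, ← Functor.map_comp, h, toCofree_counit]

/-! ### The canonical map, the action and the counit -/

theorem leftUnitor_inv_cofreeCounit :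
    (λ• A.X).inv ≫ cofreeCounit A.comon 𝕁[M] = A.comon.counit := by
  rw [cofreeCounit, ← @leftUnitor_inv_naturality_assoc M _ TwoMonoidal.bul,
    ← @unitors_equal M _ TwoMonoidal.bul, Iso.inv_hom_id, Category.comp_id]

/-- By `εμ = ϖ(ε ∘ ε)` the counit moves past `μ`, then past `ζ` by naturality; the remaining `ϖ` is
absorbed by right unitality for `J`. -/
theorem ζ_mul_cofreeCounit (X Y : M) :
    ζ X A.X Y A.X ≫ ((X ∘ᵈ Y) ◁• A.mon.mul) ≫ cofreeCounit A.comon (X ∘ᵈ Y) =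
      cofreeCounit A.comon X ∘ₘ cofreeCounit A.comon Y := by
  have h1 : ζ X A.X Y A.X ≫ ((X ∘ᵈ Y) ◁• (A.comon.counit ∘ₘ A.comon.counit)) =
      ((X ◁• A.comon.counit) ∘ₘ (Y ◁• A.comon.counit)) ≫ ζ X 𝕁[M] Y 𝕁[M] := by
    simpa using (ζ_natural (𝟙 X) A.comon.counit (𝟙 Y) A.comon.counit).symm
  have h2 : ((X ∘ᵈ Y) ◁• A.mon.mul) ≫ ((X ∘ᵈ Y) ◁• A.comon.counit) =
      ((X ∘ᵈ Y) ◁• (A.comon.counit ∘ₘ A.comon.counit)) ≫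
        ((X ∘ᵈ Y) ◁• (monJ (M := M)).mul) := by
    simp only [← whiskerLeft_comp, A.mul_counit]
  rw [cofreeCounit, reassoc_of% h2, reassoc_of% h1, right_unitality_J,
    @tensorHom_comp_tensorHom M _ TwoMonoidal.circ]
  rfl

/-- The counit undoes the coaction in the first factor of `ς`, leaving only `ε` on `A`. -/
theorem canonicalMap_cofreeCounit (N : RightComodule A.comon) :
    canonicalMap A N ≫ cofreeCounit A.comon (N.X ∘ᵈ 𝕁[M]) =
      (N.X ◁∘ A.comon.counit) := by
  rw [canonicalMap]
  simp only [Category.assoc]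
  rw [ζ_mul_cofreeCounit]
  simp only [← @id_tensorHom M _ TwoMonoidal.circ, ← @tensorHom_id M _ TwoMonoidal.circ,
    tensorHom_comp_tensorHom, Category.id_comp]
  rw [coact_cofreeCounit, leftUnitor_inv_cofreeCounit]

theorem comparisonAct_cofreeCounit (Q : RightModule (monJ (M := M))) :
    comparisonAct A Q ≫ cofreeCounit A.comon Q.X =
      (cofreeCounit A.comon Q.X ∘ₘ A.comon.counit) ≫ Q.act := by
  rw [comparisonAct, @tensorHom_def' M _ TwoMonoidal.bul]
  simp only [Category.assoc]
  rw [cofreeCounit_naturality, reassoc_of% ζ_mul_cofreeCounit]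
  simp only [← @id_tensorHom M _ TwoMonoidal.circ, tensorHom_comp_tensorHom_assoc,
    Category.id_comp]
  rw [leftUnitor_inv_cofreeCounit]

/-- Naturality of `ζ` in its first variable: `ς` and the action on `Q • A` are built from the same
`ζ` and `μ`. -/
theorem canonicalMap_liftHom (N : RightComodule A.comon) (Q : RightModule (monJ (M := M)))
    (g : N.X ⟶ Q.X) :
    canonicalMap A N ≫ (liftHom Q g ▷• A.X) =
      ((N.coact ≫ (g ▷• A.X)) ▷∘ A.X) ≫ comparisonAct A Q := by
  have h := ζ_whiskerRight g (𝟙 A.X) 𝕁[M] A.X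
  simp only [tensorHom_id, id_whiskerRight] at h
  rw [canonicalMap, comparisonAct, liftHom, @tensorHom_def' M _ TwoMonoidal.bul]
  simp only [comp_whiskerRight, Category.assoc, ← whisker_exchange_assoc, reassoc_of% h]

/-- The case of the cofree comodule with `g = e_Q`, where the coaction followed by `e_Q • A` is the
identity. Thus `ς` turns `π_Q • A` into the action. -/
theorem canonicalMap_freeCofreeCounit (Q : RightModule (monJ (M := M))) :
    canonicalMap A (cofreeObj A.comon Q.X) ≫
      (liftHom Q (cofreeCounit A.comon Q.X) ▷• A.X) = comparisonAct A Q := by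
  refine (canonicalMap_liftHom A (cofreeObj A.comon Q.X) Q
    (cofreeCounit A.comon Q.X)).trans ?_
  change ((cofreeCoact A.comon Q.X ≫ (cofreeCounit A.comon Q.X ▷• A.X)) ▷∘ A.X) ≫ _ = _
  rw [cofreeCoact_counit, @id_whiskerRight M _ TwoMonoidal.circ, Category.id_comp]

/-- After composition with `ς`, the left side becomes the action of `A` followed by `h ≫ e_Q`, and
the right side becomes `(P • A) ∘ ε` followed by the extension of `h ≫ e_Q`. These agree since `h`
is `A`-linear and `e_Q` carries the action of `A` to that of `J` along `ε`. -/
theorem liftHom_cofreeCounit_comp {P Q : RightModule (monJ (M := M))}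
    [IsIso (canonicalMap A (cofreeObj A.comon P.X))] (h : P.X •ᵈ A.X ⟶ Q.X •ᵈ A.X)
    (hact : comparisonAct A P ≫ h = (h ▷∘ A.X) ≫ comparisonAct A Q) :
    (liftHom P (cofreeCounit A.comon P.X) ▷• A.X) ≫ h ≫ cofreeCounit A.comon Q.X =
      cofreeCounit A.comon ((P.X •ᵈ A.X) ∘ᵈ 𝕁[M]) ≫
        liftHom Q (h ≫ cofreeCounit A.comon Q.X) := by
  have h1 : canonicalMap A (cofreeObj A.comon P.X) ≫
      cofreeCounit A.comon ((P.X •ᵈ A.X) ∘ᵈ 𝕁[M]) = ((P.X •ᵈ A.X) ◁∘ A.comon.counit) :=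
    canonicalMap_cofreeCounit A (cofreeObj A.comon P.X)
  have h2 : comparisonAct A P ≫ h ≫ cofreeCounit A.comon Q.X =
      ((P.X •ᵈ A.X) ◁∘ A.comon.counit) ≫ liftHom Q (h ≫ cofreeCounit A.comon Q.X) := by
    rw [reassoc_of% hact, comparisonAct_cofreeCounit, liftHom,
      @tensorHom_def M _ TwoMonoidal.circ]
    simp [whisker_exchange_assoc]
  -- The only place where invertibility of `ς` enters.
  refine (cancel_epi (canonicalMap A (cofreeObj A.comon P.X))).1 ?_
  refine (Category.assoc _ _ _).symm.trans ((congrArg (· ≫ h ≫ cofreeCounit A.comon Q.X)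
    (canonicalMap_freeCofreeCounit A P)).trans (h2.trans ?_))
  exact (congrArg (· ≫ liftHom Q (h ≫ cofreeCounit A.comon Q.X)) h1).symm.trans
    (Category.assoc _ _ _)

/-- A morphism of Hopf modules `P • A ⟶ Q • A` induces a morphism of `J`-modules
`(P • A) ∘ J ⟶ Q` that coequalizes the canonical pair. -/
theorem freeCofree_lift_condition {P Q : RightModule (monJ (M := M))}
    [IsIso (canonicalMap A (cofreeObj A.comon P.X))] (h : P.X •ᵈ A.X ⟶ Q.X •ᵈ A.X)
    (hact : comparisonAct A P ≫ h = (h ▷∘ A.X) ≫ comparisonAct A Q) :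
    (freeCofree A).map ((freeCofreeCounit A).app P) ≫
        RightModule.lift Q (h ≫ cofreeCounit A.comon Q.X) =
      (freeCofreeCounit A).app ((freeCofree A).obj P) ≫
        RightModule.lift Q (h ≫ cofreeCounit A.comon Q.X) :=
  (free_map_lift _ _).trans ((congrArg (RightModule.lift Q)
    (liftHom_cofreeCounit_comp A h hact)).trans (lift_comp (P := (freeCofree A).obj P)
      (cofreeCounit A.comon ((P.X •ᵈ A.X) ∘ᵈ 𝕁[M]))
      (RightModule.lift Q (h ≫ cofreeCounit A.comon Q.X))).symm)

/-- Shows that `π_P ≫ f` depends on `f` only through `f • A`. -/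
theorem freeCofreeCounit_comp {P Q : RightModule (monJ (M := M))} (f : P ⟶ Q) :
    (freeCofreeCounit A).app P ≫ f =
      RightModule.lift Q ((f.hom ▷• A.X) ≫ cofreeCounit A.comon Q.X) := by
  rw [cofreeCounit_naturality]
  exact lift_comp _ _

end Comparison

/-! ### Conclusion -/

/-- Full faithfulness of the comparison functor. -/
theorem theorem3p13 {M : Type u} [Category.{v} M] [DuoidalCategory M]
    [IsIdempotentComplete M] [MonadicRightAdjoint (functorG M)] (A : Bimonoid M)
    (hς : ∀ Q : RightComodule A.comon, IsIso (canonicalMap A Q)) :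
    (comparisonFunctor A).Full ∧ (comparisonFunctor A).Faithful := by
  have key {P Q : RightModule (monJ (M := M))}
      (h : (comparisonFunctor A).obj P ⟶ (comparisonFunctor A).obj Q) :=
    have := hς (RightComodule.cofreeObj A.comon P.X)
    existsUnique_factor_of_monadic_of_split (functorG M) (freeCofree A) (freeCofreeCounit A)
      (freeCofreeSection A) (freeCofreeSection_counit A) _
      (freeCofree_lift_condition A (Q := Q) h.hom h.act_hom)
  refine ⟨⟨fun {P Q} h => ?_⟩, ⟨fun {P Q} f g hfg => ?_⟩⟩
  · obtain ⟨f, hf, -⟩ := key h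
    have hf' : RightComodule.cofreeCounit A.comon P.X ≫ f.hom =
        h.hom ≫ RightComodule.cofreeCounit A.comon Q.X := by
      -- Restricting along the unit `P • A ⟶ (P • A) ∘ J` turns the factorization through `π_P` into
      -- an equation with `e_P`.
      have := congrArg (fun φ => RightModule.freeUnit monJ (P.X •ᵈ A.X) ≫ φ.hom)
        ((RightModule.lift_comp _ f).symm.trans hf)
      exact (RightModule.freeUnit_liftHom Q _).symm.trans
        (this.trans (RightModule.freeUnit_liftHom Q _))
    refine ⟨f, HopfModule.Hom.ext ?_⟩
    -- Both `f • A` and `h` are colinear maps of cofree comodules with the same composite with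
    -- `e_Q`, so they coincide.
    have h1 := RightComodule.eq_cofreeCoact_comp A.comon (f.hom ▷• A.X)
      ((RightComodule.cofree A.comon).map f.hom).hom_coact
    have h2 := RightComodule.eq_cofreeCoact_comp A.comon (Z := Q.X) h.hom h.hom_coact
    rw [RightComodule.cofreeCounit_naturality, hf'] at h1
    exact h1.trans h2.symm
  · have h : (f.hom ▷• A.X) = (g.hom ▷• A.X) := congrArg HopfModule.Hom.hom hfg
    -- Both `f` and `g` solve the factorization problem posed by `g • A`.
    refine (key ((comparisonFunctor A).map g)).unique ?_ (freeCofreeCounit_comp A g)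
    rw [freeCofreeCounit_comp, h]
    rfl
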